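/- Let $\bar\gamma_1,\bar\gamma_2>0$, $m_1,m_2>1/2$, $m_{s1},m_{s2}>1$, and let $\gamma_1,\gamma_2$ be independent random variables such that, for $\ell\in\{1,2\}$, $\gamma_\ell$ has the squared Fisher–Snedecor $\mathcal F(\bar\gamma_\ell,m_\ell,m_{s\ell})$ distribution, i.e. the probability density $$f_{\gamma_\ell}(y)=\frac{m_\ell^{m_\ell}(m_{s\ell}-1)^{m_{s\ell}}\,\bar\gamma_\ell^{\,m_{s\ell}}\,y^{m_\ell-1}}{B(m_\ell,m_{s\ell})\,\bigl(m_\ell y+(m_{s\ell}-1)\bar\gamma_\ell\bigr)^{m_\ell+m_{s\ell}}}\quad(y>0),$$ and $0$ for $y\le 0$, where $B$ is the Beta function. Let $X=\gamma_1/\gamma_2$ and $$c=\frac{(m_{s2}-1)\,\bar\gamma_2\,m_1}{(m_{s1}-1)\,\bar\gamma_1\,m_2}.$$ Then the following hold. (i) $X$ has a probability density $f_X$, which vanishes on $(-\infty,0]$ and for $x>0$ is given by $$f_X(x)=\frac{B(m_1+m_2,\,m_{s1}+m_{s2})\,x^{m_1-1}}{B(m_1,m_{s1})\,B(m_2,m_{s2})}\;c^{m_1}\;{}_2F_1\Bigl(m_1+m_{s1},\,m_1+m_2;\,\sum_{\ell=1}^2(m_\ell+m_{s\ell});\,1-cx\Bigr).$$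 (ii) For every $x>0$ the cumulative distribution function of $X$ is $$F_X(x)=\frac{(cx)^{m_1}}{\prod_{i=1}^2\Gamma(m_i)\Gamma(m_{si})}\;G^{3,2}_{3,3}\left(\frac1{cx}\,\middle|\,\begin{matrix}1,\;1-m_{s2}+m_1,\;m_1+1\\ m_1,\;m_1+m_{s1},\;m_1+m_2\end{matrix}\right).$$ (iii) For every $s>0$ the moment generating function $\mathcal M_X(s)=\mathbb E[e^{-sX}]$ is $$\mathcal M_X(s)=\frac{(c/s)^{m_1}}{\prod_{i=1}^2\Gamma(m_i)\Gamma(m_{si})}\;G^{2,3}_{3,2}\left(\frac cs\,\middle|\,\begin{matrix}1-m_1-m_{s1},\;1-m_1-m_2,\;1-m_1\\ 0,\;-m_1+m_{s2}\end{matrix}\right).$$ Here ${}_2F_1$ is the Gauss hypergeometric function, given for $0<\beta<\kappa$ and real $z<1$ by ${}_2F_1(\alpha,\beta;\kappa;z)=\frac1{B(\beta,\kappa-\beta)}\int_0^1t^{\beta-1}(1-t)^{\kappa-\beta-1}(1-tz)^{-\alpha}\,dt$, and $G$ is Meijer's function $$G^{m,n}_{p,q}\left(z\,\middle|\,\begin{matrix}a_1,\dots,a_p\\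 b_1,\dots,b_q\end{matrix}\right)=\frac1{2\pi i}\int_{\sigma-i\infty}^{\sigma+i\infty}\frac{\prod_{j=1}^m\Gamma(b_j-w)\,\prod_{j=1}^n\Gamma(1-a_j+w)}{\prod_{j=m+1}^q\Gamma(1-b_j+w)\,\prod_{j=n+1}^p\Gamma(a_j-w)}\,z^w\,dw,$$ with $\sigma$ such that the poles of the $\Gamma(b_j-w)$, $j\le m$, lie to the right of the line and those of the $\Gamma(1-a_j+w)$, $j\le n$, to its left. In (ii) and (iii) such $\sigma$ exist, and for every such $\sigma$ the integral converges absolutely and has the same value. -/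

import Mathlib

open MeasureTheory ProbabilityTheory

noncomputable section

/-- The density of the squared Fisher-Snedecor `F` distribution with average SNR `g`, fading
parameter `m` and shadowing parameter `ms`. It vanishes off the positive half-line. -/
def squaredFPDF (g m ms : ℝ) (x : ℝ) : ℝ :=
  if 0 < x then
    m ^ m * (ms - 1) ^ ms * g ^ ms * x ^ (m - 1) /
      (beta m ms * (m * x + (ms - 1) * g) ^ (m + ms))
  else 0

/-- The squared Fisher-Snedecor `F` distribution, as a measure on the real line. -/
def squaredFMeasure (g m ms : ℝ) : Measure ℝ :=
  volume.withDensity fun x => ENNReal.ofReal (squaredFPDF g m ms x)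

/-- The Gauss hypergeometric function `₂F₁(a, b; c; z)` for real parameters `0 < b < c` and real
`z < 1`, by its Euler integral. On this whole range of `z`, which is not contained in the disc of
convergence of the hypergeometric series, it is the analytic continuation of that series. -/
def gaussHypergeometric (a b c z : ℝ) : ℝ :=
  1 / beta b (c - b) *
    ∫ t in (0 : ℝ)..1, t ^ (b - 1) * (1 - t) ^ (c - b - 1) * (1 - t * z) ^ (-a)

/-- The integrand of the Mellin-Barnes integral of Meijer's function `G^{m,n}_{p,q}(z | a; b)`:
`∏_{j ≤ m} Γ(b_j - s) ∏_{j ≤ n} Γ(1 - a_j + s) /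
  (∏_{j > m} Γ(1 - b_j + s) ∏_{j > n} Γ(a_j - s)) * z ^ s`.
The indices of `a` and `b` start at zero here. -/
def meijerIntegrand (m n : ℕ) {p q : ℕ} (a : Fin p → ℂ) (b : Fin q → ℂ) (z s : ℂ) : ℂ :=
  (∏ j : Fin q, if (j : ℕ) < m then Complex.Gamma (b j - s)
      else (Complex.Gamma (1 - b j + s))⁻¹) *
    (∏ j : Fin p, if (j : ℕ) < n then Complex.Gamma (1 - a j + s)
      else (Complex.Gamma (a j - s))⁻¹) * z ^ s

/-- The abscissas `σ` of the vertical lines that have all poles of `Γ(1 - a_j + s)`, `j ≤ n`, on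
their left and all poles of `Γ(b_j - s)`, `j ≤ m`, on their right. -/
def meijerAbscissas (m n : ℕ) {p q : ℕ} (a : Fin p → ℂ) (b : Fin q → ℂ) : Set ℝ :=
  {σ | (∀ j : Fin p, (j : ℕ) < n → (a j).re - 1 < σ) ∧
    ∀ j : Fin q, (j : ℕ) < m → σ < (b j).re}

/-- The Mellin-Barnes integral `(1 / 2πi) ∫ … ds` along the line from `σ - i∞` to `σ + i∞`. -/
def meijerLineIntegral (m n : ℕ) {p q : ℕ} (a : Fin p → ℂ) (b : Fin q → ℂ) (z : ℂ) (σ : ℝ) : ℂ :=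
  1 / (2 * (Real.pi : ℂ)) * ∫ t : ℝ, meijerIntegrand m n a b z ((σ : ℂ) + (t : ℂ) * Complex.I)

open Classical in
/-- Meijer's function `G^{m,n}_{p,q}(z | a; b)`, by a Mellin-Barnes integral along a vertical line
that separates the two families of poles. It has its usual meaning when `MeijerGConverges` holds. -/
def meijerG (m n : ℕ) {p q : ℕ} (a : Fin p → ℂ) (b : Fin q → ℂ) (z : ℂ) : ℂ :=
  if h : (meijerAbscissas m n a b).Nonempty then meijerLineIntegral m n a b z h.some else 0

/-- The Mellin-Barnes integral for `G^{m,n}_{p,q}(z | a; b)` is well defined: some vertical line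
separates the two families of poles, and along each such line the integral converges absolutely
and has the same value. -/
def MeijerGConverges (m n : ℕ) {p q : ℕ} (a : Fin p → ℂ) (b : Fin q → ℂ) (z : ℂ) : Prop :=
  (meijerAbscissas m n a b).Nonempty ∧
    ∀ σ ∈ meijerAbscissas m n a b,
      Integrable (fun t : ℝ => meijerIntegrand m n a b z ((σ : ℂ) + (t : ℂ) * Complex.I)) ∧
        meijerLineIntegral m n a b z σ = meijerG m n a b z

end

noncomputable section

/-! Dividing `γ_ℓ` by `(ms_ℓ - 1) g_ℓ / m_ℓ` turns it into a beta prime variable with parameters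
`m_ℓ`, `ms_ℓ`. With `Y`, `Z` the two rescaled variables and `R = Y / Z`, the quotient of the two
scales is exactly `c`, so `X = R / c` and everything reduces to `R`.

The density of `R` at `x > 0` is `∫ y f(yx) g(y) dy` over `y > 0`. The substitution `y = t / (1 -
t)` turns it into the Euler integral of `₂F₁` at `1 - x` (`lintegral_betaPrimePDF_mul`).

The distribution function and the moment generating function are both of the form `𝔼[k (v R)]`: `k`
is the indicator of `(0, 1]` with `v = 1 / (c x)`, or `k x = exp (-x)` with `v = s / c`. As a
function of `v`, this expectation has Mellin transform `K(u) 𝔼[R ^ (-u)]`, where `K(u)` is `1 / u =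
Γ(u) / Γ(u + 1)` or `Γ(u)`. By independence `𝔼[R ^ (-u)] = 𝔼[Y ^ (-u)] 𝔼[Z ^ u]`, a product of four
Gamma factors up to normalization. Mellin inversion on a line with `0 < re u < min m₁ ms₂` then
gives the Mellin-Barnes integral (`mellinBarnes_div_betaPrime`), and an affine change of `u` matches
it with Meijer's integrand. No contour is ever shifted: every admissible line returns the same
expectation, so the value cannot depend on the line. -/

/-! ### The substitution `y = t / (1 - t)` and the Beta integral on the half-line -/

theorem hasDerivWithinAt_div_one_sub {t : ℝ} (ht : t ∈ Set.Ioo (0 : ℝ) 1) :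
    HasDerivWithinAt (fun t : ℝ => t / (1 - t)) (1 / (1 - t) ^ 2) (Set.Ioo 0 1) t := by
  have h : (1 : ℝ) - t ≠ 0 := by linarith [ht.2]
  have := ((hasDerivAt_id t).div ((hasDerivAt_id t).const_sub 1) h).hasDerivWithinAt
    (s := Set.Ioo 0 1)
  convert! this using 1
  simp

theorem injOn_div_one_sub : Set.InjOn (fun t : ℝ => t / (1 - t)) (Set.Ioo 0 1) := by
  intro a ha b hb h
  have h1 : (1 : ℝ) - a ≠ 0 := by linarith [ha.2]
  have h2 : (1 : ℝ) - b ≠ 0 := by linarith [hb.2]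
  simp only at h
  rw [div_eq_div_iff h1 h2] at h
  linarith

theorem image_div_one_sub : (fun t : ℝ => t / (1 - t)) '' Set.Ioo 0 1 = Set.Ioi 0 := by
  ext y
  constructor
  · rintro ⟨t, ht, rfl⟩
    exact div_pos ht.1 (by linarith [ht.2])
  · intro hy
    have hy : 0 < y := hy
    have h1 : 0 < 1 + y := by linarith
    refine ⟨y / (1 + y), ⟨by positivity, by rw [div_lt_one h1]; linarith⟩, ?_⟩
    simp only
    field_simp
    ring

/-- The substitution `y = t / (1 - t)` from `(0, 1)` to the positive half-line. -/
theorem setIntegral_Ioi_eq_Ioo {E : Type*} [NormedAddCommGroup E] [NormedSpace ℝ E]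
    (g : ℝ → E) :
    ∫ y in Set.Ioi 0, g y = ∫ t in Set.Ioo (0 : ℝ) 1, (1 / (1 - t) ^ 2) • g (t / (1 - t)) := by
  rw [← image_div_one_sub, integral_image_eq_integral_abs_deriv_smul measurableSet_Ioo
    (fun t ht => hasDerivWithinAt_div_one_sub ht) injOn_div_one_sub]
  refine setIntegral_congr_fun measurableSet_Ioo fun t ht => ?_
  rw [abs_of_nonneg (by positivity)]

theorem integrableOn_Ioi_iff_Ioo {E : Type*} [NormedAddCommGroup E] [NormedSpace ℝ E]
    (g : ℝ → E) :
    IntegrableOn g (Set.Ioi 0) ↔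
      IntegrableOn (fun t : ℝ => (1 / (1 - t) ^ 2) • g (t / (1 - t))) (Set.Ioo 0 1) := by
  rw [← image_div_one_sub, integrableOn_image_iff_integrableOn_abs_deriv_smul measurableSet_Ioo
    (fun t ht => hasDerivWithinAt_div_one_sub ht) injOn_div_one_sub]
  refine integrableOn_congr_fun (fun t ht => ?_) measurableSet_Ioo
  rw [abs_of_nonneg (by positivity)]

theorem betaPrime_integrand_comp (a b : ℂ) {t : ℝ} (ht : t ∈ Set.Ioo (0 : ℝ) 1) :
    ((1 / (1 - t) ^ 2 : ℝ)) •
      (((t / (1 - t) : ℝ) : ℂ) ^ (a - 1) * ((1 + t / (1 - t) : ℝ) : ℂ) ^ (-(a + b))) =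
    (t : ℂ) ^ (a - 1) * (1 - (t : ℂ)) ^ (b - 1) := by
  have h0 : 0 < t := ht.1
  have h1 : 0 < 1 - t := by linarith [ht.2]
  have h2 : 1 + t / (1 - t) = (1 - t)⁻¹ := by field_simp; ring
  have hne : ((1 - t : ℝ) : ℂ) ≠ 0 := by exact_mod_cast h1.ne'
  rw [h2, div_eq_mul_inv t, Complex.ofReal_mul,
    Complex.mul_cpow_ofReal_nonneg h0.le (by positivity), Complex.ofReal_inv,
    Complex.inv_cpow _ _ (by rw [Complex.arg_ofReal_of_nonneg h1.le]; exact Real.pi_pos.ne),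
    Complex.inv_cpow _ _ (by rw [Complex.arg_ofReal_of_nonneg h1.le]; exact Real.pi_pos.ne),
    ← Complex.cpow_neg, ← Complex.cpow_neg, Complex.real_smul]
  -- The Jacobian becomes a complex power, so that all exponents of `1 - t` can be added.
  have h3 : ((1 / (1 - t) ^ 2 : ℝ) : ℂ) = ((1 - t : ℝ) : ℂ) ^ (-2 : ℂ) := by
    rw [Complex.cpow_neg]; norm_num
  rw [h3, show (1 - (t : ℂ)) = ((1 - t : ℝ) : ℂ) by push_cast; ring]
  have : (b - 1 : ℂ) = -2 + -(a - 1) + - -(a + b) := by ring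
  rw [this, Complex.cpow_add _ _ hne, Complex.cpow_add _ _ hne]
  ring

theorem integrableOn_betaPrime {a b : ℂ} (ha : 0 < a.re) (hb : 0 < b.re) :
    IntegrableOn (fun y : ℝ => (y : ℂ) ^ (a - 1) * ((1 + y : ℝ) : ℂ) ^ (-(a + b)))
      (Set.Ioi 0) := by
  rw [integrableOn_Ioi_iff_Ioo]
  refine IntegrableOn.congr_fun ?_ (fun t ht => (betaPrime_integrand_comp a b ht).symm)
    measurableSet_Ioo
  have := Complex.betaIntegral_convergent ha hb
  rwa [intervalIntegrable_iff_integrableOn_Ioo_of_le zero_le_one] at this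

/-- No convergence hypothesis is needed: the change of variables is an identity of Bochner integrals
even when both are zero by default. -/
theorem setIntegral_betaPrime (a b : ℂ) :
    ∫ y in Set.Ioi (0 : ℝ), (y : ℂ) ^ (a - 1) * ((1 + y : ℝ) : ℂ) ^ (-(a + b)) =
      Complex.betaIntegral a b := by
  rw [setIntegral_Ioi_eq_Ioo, Complex.betaIntegral,
    intervalIntegral.integral_of_le zero_le_one, integral_Ioc_eq_integral_Ioo]
  exact setIntegral_congr_fun measurableSet_Ioo fun t ht => betaPrime_integrand_comp a b ht

/-! ### Beta prime distributions and their complex moments -/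

/-- The density of the beta prime distribution. -/
def betaPrimePDF (a b x : ℝ) : ℝ :=
  if 0 < x then x ^ (a - 1) * (1 + x) ^ (-(a + b)) / beta a b else 0

/-- The beta prime distribution. -/
def betaPrimeMeasure (a b : ℝ) : Measure ℝ :=
  volume.withDensity fun x => ENNReal.ofReal (betaPrimePDF a b x)

@[fun_prop]
theorem measurable_betaPrimePDF (a b : ℝ) : Measurable (betaPrimePDF a b) :=
  Measurable.ite measurableSet_Ioi (by fun_prop) (by fun_prop)

theorem betaPrimePDF_nonneg {a b : ℝ} (ha : 0 < a) (hb : 0 < b) (x : ℝ) :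
    0 ≤ betaPrimePDF a b x := by
  unfold betaPrimePDF
  have := beta_pos ha hb
  split_ifs with h <;> positivity

/-- A factor `y ^ u` shifts the parameters `(a, b)` to `(a + u, b - u)` and keeps their sum, so each
moment is again a Beta integral. -/
theorem betaPrime_moment_integrand {a b : ℝ} (u : ℂ) {y : ℝ} (hy : 0 < y) :
    betaPrimePDF a b y • (y : ℂ) ^ u =
      (y : ℂ) ^ ((a + u) - 1) * ((1 + y : ℝ) : ℂ) ^ (-((a + u) + (b - u))) / beta a b := by
  have h1 : 0 < 1 + y := by linarith
  rw [betaPrimePDF, if_pos hy, Complex.real_smul]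
  push_cast
  rw [Complex.ofReal_cpow hy.le, Complex.ofReal_cpow h1.le]
  have : (y : ℂ) ^ ((a : ℂ) + u - 1) = (y : ℂ) ^ ((a - 1 : ℝ) : ℂ) * (y : ℂ) ^ u := by
    rw [← Complex.cpow_add _ _ (by exact_mod_cast hy.ne')]
    push_cast; ring_nf
  rw [this]
  have : (-(a + u + (b - u)) : ℂ) = ((-(a + b) : ℝ) : ℂ) := by push_cast; ring
  rw [this]
  push_cast
  ring

theorem integrable_cpow_betaPrimeMeasure {a b : ℝ} (ha : 0 < a) (hb : 0 < b) {u : ℂ}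
    (h1 : 0 < a + u.re) (h2 : 0 < b - u.re) :
    Integrable (fun y : ℝ => (y : ℂ) ^ u) (betaPrimeMeasure a b) := by
  rw [betaPrimeMeasure, integrable_withDensity_iff_integrable_smul' (by fun_prop) (by simp)]
  simp_rw [ENNReal.toReal_ofReal (betaPrimePDF_nonneg ha hb _)]
  rw [← integrableOn_iff_integrable_of_support_subset (s := Set.Ioi 0)]
  · refine IntegrableOn.congr_fun ?_ (fun y hy => (betaPrime_moment_integrand u hy).symm)
      measurableSet_Ioi
    exact (integrableOn_betaPrime (by simpa using h1) (by simpa using h2)).div_const _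
  · intro x hx
    by_contra h
    exact hx (by simp [betaPrimePDF, show ¬ 0 < x from h])

theorem integral_cpow_betaPrimeMeasure {a b : ℝ} (ha : 0 < a) (hb : 0 < b) {u : ℂ}
    (h1 : 0 < a + u.re) (h2 : 0 < b - u.re) :
    ∫ y : ℝ, (y : ℂ) ^ u ∂(betaPrimeMeasure a b) =
      Complex.Gamma (a + u) * Complex.Gamma (b - u) / (Real.Gamma a * Real.Gamma b) := by
  rw [betaPrimeMeasure, integral_withDensity_eq_integral_toReal_smul (by fun_prop) (by simp)]
  simp_rw [ENNReal.toReal_ofReal (betaPrimePDF_nonneg ha hb _)]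
  rw [← setIntegral_eq_integral_of_forall_compl_eq_zero (s := Set.Ioi 0),
    setIntegral_congr_fun measurableSet_Ioi (fun y hy => betaPrime_moment_integrand u hy),
    integral_div, setIntegral_betaPrime, Complex.betaIntegral_eq_Gamma_mul_div]
  · have e : (a + u + (b - u) : ℂ) = ((a + b : ℝ) : ℂ) := by push_cast; ring
    have hne : (Real.Gamma (a + b) : ℂ) ≠ 0 := by
      exact_mod_cast (Real.Gamma_pos_of_pos (add_pos ha hb)).ne'
    have hna : (Real.Gamma a : ℂ) ≠ 0 := by exact_mod_cast (Real.Gamma_pos_of_pos ha).ne'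
    have hnb : (Real.Gamma b : ℂ) ≠ 0 := by exact_mod_cast (Real.Gamma_pos_of_pos hb).ne'
    rw [e, Complex.Gamma_ofReal, beta]
    push_cast
    field_simp
  · simpa using h1
  · simpa using h2
  · intro x hx
    simp [betaPrimePDF, show ¬ 0 < x from hx]

theorem ae_pos_betaPrimeMeasure (a b : ℝ) : ∀ᵐ y ∂(betaPrimeMeasure a b), 0 < y := by
  rw [betaPrimeMeasure, ae_withDensity_iff (by fun_prop)]
  refine Filter.Eventually.of_forall fun x hx => ?_
  by_contra h
  exact hx (by simp [betaPrimePDF, h])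

/-! ### Densities of rescaled variables and of quotients -/

theorem map_div_const_withDensity {f : ℝ → ENNReal} (hf : Measurable f) {a : ℝ} (ha : 0 < a) :
    (volume.withDensity f).map (fun x => x / a) =
      volume.withDensity fun x => ENNReal.ofReal a * f (a * x) := by
  ext s hs
  have hm : Measurable fun x : ℝ => x / a := by fun_prop
  rw [Measure.map_apply hm hs, withDensity_apply _ (hm hs), withDensity_apply _ hs,
    ← lintegral_indicator (hm hs), ← lintegral_indicator hs]
  conv_lhs => rw [← Real.smul_map_volume_mul_left ha.ne']
  rw [lintegral_smul_measure, lintegral_map (hf.indicator (hm hs)) (by fun_prop), smul_eq_mul,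
    ← lintegral_const_mul' _ _ ENNReal.ofReal_ne_top, abs_of_pos ha]
  refine lintegral_congr fun x => ?_
  by_cases h : x ∈ s <;> simp [Set.indicator, h, ha.ne']

/-- The density of the quotient of two independent random variables with densities. -/
theorem map_div_prod_withDensity {f g : ℝ → ENNReal} (hf : Measurable f) (hg : Measurable g)
    [SFinite (volume.withDensity f)] [SFinite (volume.withDensity g)] :
    ((volume.withDensity f).prod (volume.withDensity g)).map (fun p : ℝ × ℝ => p.1 / p.2) =
      volume.withDensity fun x => ∫⁻ y, ENNReal.ofReal |y| * f (y * x) * g y := by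
  ext s hs
  have hm : Measurable fun p : ℝ × ℝ => p.1 / p.2 := by fun_prop
  rw [Measure.map_apply hm hs, withDensity_apply _ hs, Measure.prod_apply_symm (hm hs),
    lintegral_withDensity_eq_lintegral_mul _ hg (measurable_measure_prodMk_right (hm hs)),
    ← lintegral_indicator hs]
  have e1 : ∀ᵐ y : ℝ, (g * fun y => (volume.withDensity f)
      ((fun x => (x, y)) ⁻¹' ((fun p : ℝ × ℝ => p.1 / p.2) ⁻¹' s))) y =
      ∫⁻ x, s.indicator (fun x => ENNReal.ofReal |y| * f (y * x) * g y) x := by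
    -- The inner substitution `x ↦ y * x` needs `y ≠ 0`; the excluded point is Lebesgue null.
    filter_upwards [compl_mem_ae_iff.2 (measure_singleton (0 : ℝ))] with y hy
    have hy : y ≠ 0 := hy
    have hs' : MeasurableSet ((fun x => (x, y)) ⁻¹' ((fun p : ℝ × ℝ => p.1 / p.2) ⁻¹' s)) :=
      (hm.comp (by fun_prop : Measurable fun x : ℝ => (x, y))) hs
    have hmi : Measurable fun x => ENNReal.ofReal |y| *
        ((fun x => (x, y)) ⁻¹' ((fun p : ℝ × ℝ => p.1 / p.2) ⁻¹' s)).indicator f (y * x) :=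
      ((hf.indicator hs').comp (measurable_const_mul y)).const_mul _
    rw [Pi.mul_apply, withDensity_apply _ hs', ← lintegral_indicator hs']
    conv_lhs => rw [← Real.smul_map_volume_mul_left hy]
    rw [lintegral_smul_measure, lintegral_map (hf.indicator hs') (by fun_prop), smul_eq_mul,
      ← lintegral_const_mul' _ _ ENNReal.ofReal_ne_top,
      ← lintegral_const_mul _ hmi]
    refine lintegral_congr fun x => ?_
    by_cases h : x ∈ s
    · simp [Set.indicator, h, hy]; ring
    · simp [Set.indicator, h, hy]
  rw [lintegral_congr_ae e1, lintegral_lintegral_swap]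
  · refine lintegral_congr fun x => ?_
    by_cases h : x ∈ s <;> simp [Set.indicator, h]
  · refine Measurable.aemeasurable ?_
    exact Measurable.indicator (f := fun p : ℝ × ℝ => ENNReal.ofReal |p.1| * f (p.1 * p.2) * g p.1)
      (by fun_prop) (s := Prod.snd ⁻¹' s) (measurable_snd hs)

/-! ### Euler's integral and the density of a beta prime quotient -/

/-- With `y = t / (1 - t)`, `1 + y x = (1 - t (1 - x)) / (1 - t)` and `1 + y = 1 / (1 - t)`; the
rest is a count of exponents. -/
theorem euler_integrand_comp (a b c x : ℝ) (hx : 0 < x) {t : ℝ} (ht : t ∈ Set.Ioo (0 : ℝ) 1) :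
    (1 / (1 - t) ^ 2) • ((t / (1 - t)) ^ (b - 1) * (1 + t / (1 - t) * x) ^ (-a) *
      (1 + t / (1 - t)) ^ (-(c - a))) =
    t ^ (b - 1) * (1 - t) ^ (c - b - 1) * (1 - t * (1 - x)) ^ (-a) := by
  have h0 : 0 < t := ht.1
  have h1 : 0 < 1 - t := by linarith [ht.2]
  have h2 : 1 + t / (1 - t) = (1 - t)⁻¹ := by field_simp; ring
  have h3 : 1 + t / (1 - t) * x = (1 - t * (1 - x)) * (1 - t)⁻¹ := by field_simp; ring
  have h4 : 0 < 1 - t * (1 - x) := by nlinarith [mul_pos h0 hx]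
  have h5 : 1 / (1 - t) ^ 2 = (1 - t) ^ (-2 : ℝ) := by
    rw [Real.rpow_neg h1.le]; norm_num
  rw [h2, h3, h5, div_eq_mul_inv t, Real.mul_rpow h0.le (by positivity),
    Real.mul_rpow h4.le (by positivity), Real.inv_rpow h1.le, Real.inv_rpow h1.le,
    Real.inv_rpow h1.le, ← Real.rpow_neg h1.le, ← Real.rpow_neg h1.le, ← Real.rpow_neg h1.le,
    show c - b - 1 = -2 + -(b - 1) + - -a + - -(c - a) by ring, Real.rpow_add h1,
    Real.rpow_add h1, Real.rpow_add h1, smul_eq_mul]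
  ring

/-- The factor `1 - t (1 - x)` interpolates between `1` and `x`, hence is positive on `[0, 1]`. Its
power is continuous on this compact interval and leaves the integrability of the Beta integrand
intact. -/
theorem integrableOn_euler {a b c x : ℝ} (hb : 0 < b) (hc : b < c) (hx : 0 < x) :
    IntegrableOn (fun t : ℝ => t ^ (b - 1) * (1 - t) ^ (c - b - 1) * (1 - t * (1 - x)) ^ (-a))
      (Set.Icc 0 1) := by
  have hpos : ∀ t ∈ Set.Icc (0 : ℝ) 1, 0 < 1 - t * (1 - x) := by
    intro t ht
    rcases le_total x 1 with h | h
    · nlinarith [ht.1, ht.2]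
    · nlinarith [ht.1, ht.2]
  refine IntegrableOn.mul_continuousOn ?_ ?_ isCompact_Icc
  · have := (Complex.betaIntegral_convergent (u := b) (v := ((c - b : ℝ) : ℂ)) (by simpa)
      (by simpa))
    rw [intervalIntegrable_iff_integrableOn_Ioo_of_le zero_le_one] at this
    rw [integrableOn_Icc_iff_integrableOn_Ioo]
    refine IntegrableOn.congr_fun this.norm (fun t ht => ?_) measurableSet_Ioo
    have h1 : 0 < 1 - t := by linarith [ht.2]
    rw [norm_mul, show (1 - (t : ℂ)) = ((1 - t : ℝ) : ℂ) by push_cast; ring,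
      Complex.norm_cpow_eq_rpow_re_of_pos ht.1, Complex.norm_cpow_eq_rpow_re_of_pos h1]
    simp
  · refine ContinuousOn.rpow_const (by fun_prop) fun t ht => Or.inl (hpos t ht).ne'

theorem integrableOn_euler_Ioi {a b c x : ℝ} (hb : 0 < b) (hc : b < c) (hx : 0 < x) :
    IntegrableOn (fun y : ℝ => y ^ (b - 1) * (1 + y * x) ^ (-a) * (1 + y) ^ (-(c - a)))
      (Set.Ioi 0) := by
  rw [integrableOn_Ioi_iff_Ioo]
  refine IntegrableOn.congr_fun ?_ (fun t ht => (euler_integrand_comp a b c x hx ht).symm)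
    measurableSet_Ioo
  exact (integrableOn_euler hb hc hx).mono_set Set.Ioo_subset_Icc_self

theorem setIntegral_euler_Ioi {a b c x : ℝ} (hb : 0 < b) (hc : b < c) (hx : 0 < x) :
    ∫ y in Set.Ioi (0 : ℝ), y ^ (b - 1) * (1 + y * x) ^ (-a) * (1 + y) ^ (-(c - a)) =
      beta b (c - b) * gaussHypergeometric a b c (1 - x) := by
  rw [setIntegral_Ioi_eq_Ioo, gaussHypergeometric, ← mul_assoc,
    mul_one_div_cancel (beta_pos hb (sub_pos.2 hc)).ne', one_mul,
    intervalIntegral.integral_of_le zero_le_one, integral_Ioc_eq_integral_Ioo]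
  exact setIntegral_congr_fun measurableSet_Ioo fun t ht => euler_integrand_comp a b c x hx ht

/-- The left side is the quotient density in the form produced by `map_div_prod_withDensity`.
Integrability and nonnegativity allow it to be computed as a Bochner integral; for `x ≤ 0` one of
the two densities vanishes at every `y`. -/
theorem lintegral_betaPrimePDF_mul {a b a' b' : ℝ} (ha : 0 < a) (hb : 0 < b) (ha' : 0 < a')
    (hb' : 0 < b') (x : ℝ) :
    ∫⁻ y, ENNReal.ofReal |y| * ENNReal.ofReal (betaPrimePDF a b (y * x)) *
      ENNReal.ofReal (betaPrimePDF a' b' y) =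
    ENNReal.ofReal (if 0 < x then beta (a + a') (b + b') * x ^ (a - 1) / (beta a b * beta a' b') *
      gaussHypergeometric (a + b) (a + a') ((a + b) + (a' + b')) (1 - x) else 0) := by
  split_ifs with hx
  · have key : ∀ y ∈ Set.Ioi (0 : ℝ), |y| * betaPrimePDF a b (y * x) * betaPrimePDF a' b' y =
        x ^ (a - 1) / (beta a b * beta a' b') * (y ^ ((a + a') - 1) * (1 + y * x) ^ (-(a + b)) *
          (1 + y) ^ (-(((a + b) + (a' + b')) - (a + b)))) := by
      intro y hy
      have hy : 0 < y := hy
      rw [betaPrimePDF, betaPrimePDF, if_pos (mul_pos hy hx), if_pos hy, abs_of_pos hy,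
        Real.mul_rpow hy.le hx.le, show a + a' - 1 = 1 + (a - 1) + (a' - 1) by ring,
        Real.rpow_add hy, Real.rpow_add hy, Real.rpow_one,
        show (a + b) + (a' + b') - (a + b) = a' + b' by ring]
      ring
    have hc : a + a' < (a + b) + (a' + b') := by linarith
    have hint : IntegrableOn (fun y => |y| * betaPrimePDF a b (y * x) * betaPrimePDF a' b' y)
        (Set.Ioi 0) :=
      IntegrableOn.congr_fun ((integrableOn_euler_Ioi (add_pos ha ha') hc hx).const_mul _)
        (fun y hy => (key y hy).symm) measurableSet_Ioi
    have hsupp : ∀ y ∉ Set.Ioi (0 : ℝ),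
        |y| * betaPrimePDF a b (y * x) * betaPrimePDF a' b' y = 0 := by
      intro y hy
      simp [betaPrimePDF, show ¬ 0 < y from hy]
    have hnn := betaPrimePDF_nonneg ha hb
    have hnn' := betaPrimePDF_nonneg ha' hb'
    calc _ = ∫⁻ y, ENNReal.ofReal (|y| * betaPrimePDF a b (y * x) * betaPrimePDF a' b' y) := by
          refine lintegral_congr fun y => ?_
          rw [ENNReal.ofReal_mul (mul_nonneg (abs_nonneg _) (hnn _)),
            ENNReal.ofReal_mul (abs_nonneg _)]
      _ = ENNReal.ofReal (∫ y, |y| * betaPrimePDF a b (y * x) * betaPrimePDF a' b' y) := by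
          rw [ofReal_integral_eq_lintegral_ofReal]
          · refine (integrableOn_iff_integrable_of_support_subset (s := Set.Ioi 0) ?_).1 hint
            intro y hy
            by_contra h
            exact hy (hsupp y h)
          · exact Filter.Eventually.of_forall fun y =>
              mul_nonneg (mul_nonneg (abs_nonneg _) (hnn _)) (hnn' _)
      _ = _ := by
          rw [← setIntegral_eq_integral_of_forall_compl_eq_zero hsupp,
            setIntegral_congr_fun measurableSet_Ioi key, integral_const_mul,
            setIntegral_euler_Ioi (add_pos ha ha') hc hx,
            show (a + b) + (a' + b') - (a + a') = b + b' by ring]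
          congr 1
          ring
  · rw [ENNReal.ofReal_zero, lintegral_eq_zero_iff (by fun_prop)]
    refine Filter.Eventually.of_forall fun y => ?_
    by_cases hy : 0 < y
    · have : ¬ 0 < y * x := by
        push Not at hx ⊢
        exact mul_nonpos_of_nonneg_of_nonpos hy.le hx
      simp [betaPrimePDF, this]
    · simp [betaPrimePDF, hy]

/-! ### Reduction of the Fisher–Snedecor law to the beta prime law -/

theorem squaredFPDF_scale {g m ms : ℝ} (hg : 0 < g) (hm : 0 < m) (hms : 1 < ms) (x : ℝ) :
    (ms - 1) * g / m * squaredFPDF g m ms ((ms - 1) * g / m * x) = betaPrimePDF m ms x := by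
  have hk : 0 < ms - 1 := by linarith
  have hl : 0 < (ms - 1) * g / m := by positivity
  by_cases hx : 0 < x
  · have hB := beta_pos hm (by linarith : 0 < ms)
    have h1 : 0 < 1 + x := by linarith
    rw [squaredFPDF, betaPrimePDF, if_pos (mul_pos hl hx), if_pos hx]
    have e : m * ((ms - 1) * g / m * x) + (ms - 1) * g = ((ms - 1) * g) * (1 + x) := by
      field_simp; ring
    rw [e, Real.mul_rpow hl.le hx.le, Real.mul_rpow (by positivity) h1.le, Real.rpow_neg h1.le,
      Real.rpow_add (by positivity : 0 < (ms - 1) * g), Real.mul_rpow hk.le hg.le (z := ms),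
      Real.rpow_sub_one hl.ne', Real.div_rpow (by positivity) hm.le]
    have := Real.rpow_pos_of_pos hm m
    have := Real.rpow_pos_of_pos (mul_pos hk hg) m
    have := Real.rpow_pos_of_pos hk ms
    have := Real.rpow_pos_of_pos hg ms
    have := Real.rpow_pos_of_pos h1 (m + ms)
    field_simp
  · have : ¬ 0 < (ms - 1) * g / m * x := by
      push Not at hx ⊢
      exact mul_nonpos_of_nonneg_of_nonpos hl.le hx
    rw [squaredFPDF, betaPrimePDF, if_neg this, if_neg hx, mul_zero]

theorem measurable_squaredFPDF (g m ms : ℝ) : Measurable (squaredFPDF g m ms) :=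
  Measurable.ite measurableSet_Ioi (by fun_prop) (by fun_prop)

theorem map_squaredFMeasure {g m ms : ℝ} (hg : 0 < g) (hm : 0 < m) (hms : 1 < ms) :
    (squaredFMeasure g m ms).map (fun x => x / ((ms - 1) * g / m)) = betaPrimeMeasure m ms := by
  have hl : 0 < (ms - 1) * g / m := div_pos (mul_pos (by linarith) hg) hm
  rw [squaredFMeasure, map_div_const_withDensity
    (measurable_squaredFPDF g m ms).ennreal_ofReal hl, betaPrimeMeasure]
  congr 1
  ext x
  rw [← ENNReal.ofReal_mul hl.le, squaredFPDF_scale hg hm hms]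

variable {Ω : Type*} [MeasurableSpace Ω] {P : Measure Ω}

theorem hasLaw_betaPrime_of_squaredF {g m ms : ℝ} (hg : 0 < g) (hm : 0 < m) (hms : 1 < ms)
    {γ : Ω → ℝ} (h : HasLaw γ (squaredFMeasure g m ms) P) :
    HasLaw (fun ω => γ ω / ((ms - 1) * g / m)) (betaPrimeMeasure m ms) P where
  aemeasurable := h.aemeasurable.div_const _
  map_eq := by
    rw [← map_squaredFMeasure hg hm hms, ← h.map_eq,
      AEMeasurable.map_map_of_aemeasurable (by fun_prop) h.aemeasurable]
    rfl

/-- The density of the quotient of independent beta prime random variables. -/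
def betaPrimeRatioPDF (a b a' b' x : ℝ) : ℝ :=
  if 0 < x then beta (a + a') (b + b') * x ^ (a - 1) / (beta a b * beta a' b') *
      gaussHypergeometric (a + b) (a + a') ((a + b) + (a' + b')) (1 - x) else 0

theorem hasLaw_div_betaPrime [IsProbabilityMeasure P] {a b a' b' : ℝ} (ha : 0 < a) (hb : 0 < b)
    (ha' : 0 < a') (hb' : 0 < b') {Y Z : Ω → ℝ} (hY : HasLaw Y (betaPrimeMeasure a b) P)
    (hZ : HasLaw Z (betaPrimeMeasure a' b') P) (hind : IndepFun Y Z P) :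
    HasLaw (fun ω => Y ω / Z ω)
      (volume.withDensity fun x => ENNReal.ofReal (betaPrimeRatioPDF a b a' b' x)) P where
  aemeasurable := hY.aemeasurable.div hZ.aemeasurable
  map_eq := by
    have h := (indepFun_iff_map_prod_eq_prod_map_map hY.aemeasurable hZ.aemeasurable).1 hind
    have e : (fun ω => Y ω / Z ω) = (fun p : ℝ × ℝ => p.1 / p.2) ∘ fun ω => (Y ω, Z ω) := rfl
    rw [e, ← AEMeasurable.map_map_of_aemeasurable (by fun_prop)
      (hY.aemeasurable.prodMk hZ.aemeasurable), h, hY.map_eq, hZ.map_eq, betaPrimeMeasure,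
      betaPrimeMeasure, map_div_prod_withDensity (by fun_prop) (by fun_prop)]
    congr 1
    ext x
    exact lintegral_betaPrimePDF_mul ha hb ha' hb' x

/-- Measurability is read off the mixture integral that equals this density, rather than off the
hypergeometric formula. -/
theorem measurable_betaPrimeRatioPDF_ofReal {a b a' b' : ℝ} (ha : 0 < a) (hb : 0 < b)
    (ha' : 0 < a') (hb' : 0 < b') :
    Measurable fun x => ENNReal.ofReal (betaPrimeRatioPDF a b a' b' x) := by
  have : (fun x => ENNReal.ofReal (betaPrimeRatioPDF a b a' b' x)) = fun x =>
      ∫⁻ y, ENNReal.ofReal |y| * ENNReal.ofReal (betaPrimePDF a b (y * x)) *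
        ENNReal.ofReal (betaPrimePDF a' b' y) :=
    funext fun x => (lintegral_betaPrimePDF_mul ha hb ha' hb' x).symm
  rw [this]
  exact Measurable.lintegral_prod_right' (f := fun p : ℝ × ℝ => ENNReal.ofReal |p.2| *
    ENNReal.ofReal (betaPrimePDF a b (p.2 * p.1)) * ENNReal.ofReal (betaPrimePDF a' b' p.2))
    (by fun_prop)

theorem hasLaw_div_const {f : ℝ → ENNReal} (hf : Measurable f) {c : ℝ} (hc : 0 < c) {R : Ω → ℝ}
    (h : HasLaw R (volume.withDensity f) P) :
    HasLaw (fun ω => R ω / c) (volume.withDensity fun x => ENNReal.ofReal c * f (c * x)) P where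
  aemeasurable := h.aemeasurable.div_const _
  map_eq := by
    rw [← map_div_const_withDensity hf hc, ← h.map_eq,
      AEMeasurable.map_map_of_aemeasurable (by fun_prop) h.aemeasurable]
    rfl

/-! ### Moments of the quotient and Gamma bounds on vertical lines -/

/-- Complex moments of a quotient of independent beta prime random variables. -/
theorem integrable_cpow_div_betaPrime [IsProbabilityMeasure P] {a b a' b' : ℝ} (ha : 0 < a)
    (hb : 0 < b) (ha' : 0 < a') (hb' : 0 < b') {Y Z : Ω → ℝ}
    (hY : HasLaw Y (betaPrimeMeasure a b) P)
    (hZ : HasLaw Z (betaPrimeMeasure a' b') P) (hind : IndepFun Y Z P) {u : ℂ}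
    (h0 : 0 < u.re) (h1 : u.re < a) (h2 : u.re < b') :
    Integrable (fun ω => ((Y ω / Z ω : ℝ) : ℂ) ^ (-u)) P ∧
    ∫ ω, ((Y ω / Z ω : ℝ) : ℂ) ^ (-u) ∂P =
      Complex.Gamma (a - u) * Complex.Gamma (b + u) *
        (Complex.Gamma (a' + u) * Complex.Gamma (b' - u)) /
        (Real.Gamma a * Real.Gamma b * (Real.Gamma a' * Real.Gamma b')) := by
  have mY : Measurable fun y : ℝ => (y : ℂ) ^ (-u) := by fun_prop
  have mZ : Measurable fun y : ℝ => (y : ℂ) ^ u := by fun_prop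
  have pY : ∀ᵐ ω ∂P, 0 < Y ω :=
    ae_of_ae_map hY.aemeasurable (hY.map_eq ▸ ae_pos_betaPrimeMeasure a b)
  have pZ : ∀ᵐ ω ∂P, 0 < Z ω :=
    ae_of_ae_map hZ.aemeasurable (hZ.map_eq ▸ ae_pos_betaPrimeMeasure a' b')
  have e : (fun ω => ((Y ω / Z ω : ℝ) : ℂ) ^ (-u)) =ᵐ[P]
      fun ω => (Y ω : ℂ) ^ (-u) * (Z ω : ℂ) ^ u := by
    filter_upwards [pY, pZ] with ω hy hz
    rw [div_eq_mul_inv, Complex.ofReal_mul,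
      Complex.mul_cpow_ofReal_nonneg hy.le (by positivity), Complex.ofReal_inv,
      Complex.inv_cpow _ _ (by rw [Complex.arg_ofReal_of_nonneg hz.le]; exact Real.pi_pos.ne),
      ← Complex.cpow_neg, neg_neg]
  have iY : Integrable (fun ω => (Y ω : ℂ) ^ (-u)) P := by
    have := integrable_cpow_betaPrimeMeasure ha hb (u := -u) (by simp; linarith)
      (by simp; linarith)
    rw [← hY.map_eq] at this
    exact this.comp_aemeasurable hY.aemeasurable
  have iZ : Integrable (fun ω => (Z ω : ℂ) ^ u) P := by
    have := integrable_cpow_betaPrimeMeasure ha' hb' (u := u) (by linarith) (by linarith)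
    rw [← hZ.map_eq] at this
    exact this.comp_aemeasurable hZ.aemeasurable
  have vY := integral_cpow_betaPrimeMeasure ha hb (u := -u) (by simp; linarith)
      (by simp; linarith)
  have vZ := integral_cpow_betaPrimeMeasure ha' hb' (u := u) (by linarith) (by linarith)
  have hi : IndepFun (fun ω => (Y ω : ℂ) ^ (-u)) (fun ω => (Z ω : ℂ) ^ u) P :=
    hind.comp mY mZ
  refine ⟨(integrable_congr e).2 (hi.integrable_mul iY iZ), ?_⟩
  rw [integral_congr_ae e, hi.integral_fun_mul_eq_mul_integral iY.1 iZ.1]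
  have lY : ∫ ω, (Y ω : ℂ) ^ (-u) ∂P = ∫ y : ℝ, (y : ℂ) ^ (-u) ∂(betaPrimeMeasure a b) :=
    hY.integral_comp mY.aestronglyMeasurable
  have lZ : ∫ ω, (Z ω : ℂ) ^ u ∂P = ∫ y : ℝ, (y : ℂ) ^ u ∂(betaPrimeMeasure a' b') :=
    hZ.integral_comp mZ.aestronglyMeasurable
  rw [lY, lZ, vY, vZ]
  rw [div_mul_div_comm, sub_neg_eq_add, ← sub_eq_add_neg]

/-- The triangle inequality in Euler's integral, as `‖x ^ (z - 1)‖ = x ^ (re z - 1)`. -/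
theorem norm_Gamma_le_Gamma_re {z : ℂ} (hz : 0 < z.re) :
    ‖Complex.Gamma z‖ ≤ Real.Gamma z.re := by
  rw [Complex.Gamma_eq_integral hz, Complex.GammaIntegral, Real.Gamma_eq_integral hz]
  refine (norm_integral_le_integral_norm _).trans (le_of_eq ?_)
  refine setIntegral_congr_fun measurableSet_Ioi fun x hx => ?_
  rw [norm_mul, Complex.norm_cpow_eq_rpow_re_of_pos hx, Complex.norm_real,
    Real.norm_of_nonneg (Real.exp_pos _).le]
  simp

/-- Quadratic decay of the Gamma function along vertical lines. -/
theorem norm_Gamma_mul_one_add_sq_le {z : ℂ} (hz : 0 < z.re) :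
    ‖Complex.Gamma z‖ * (1 + z.im ^ 2) ≤ Real.Gamma z.re + Real.Gamma (z.re + 2) := by
  have h1 := norm_Gamma_le_Gamma_re hz
  have hz0 : z ≠ 0 := by rintro rfl; simp at hz
  have hz1 : z + 1 ≠ 0 := by
    intro h
    have := congrArg Complex.re h
    simp at this
    linarith
  -- Since `Γ(z + 2) = (z + 1) z Γ(z)`, bounding the left side gains two factors of size at least
  -- `|im z|`.
  have h2 : ‖Complex.Gamma (z + 1 + 1)‖ ≤ Real.Gamma (z.re + 2) := by
    have := norm_Gamma_le_Gamma_re (z := z + 1 + 1) (by simp; linarith)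
    convert this using 2
    simp; ring
  rw [Complex.Gamma_add_one _ hz1, Complex.Gamma_add_one _ hz0, norm_mul, norm_mul] at h2
  have i1 : |z.im| ≤ ‖z‖ := Complex.abs_im_le_norm z
  have i2 : |z.im| ≤ ‖z + 1‖ := by simpa using Complex.abs_im_le_norm (z + 1)
  have h3 : z.im ^ 2 ≤ ‖z + 1‖ * ‖z‖ := by
    rw [← sq_abs, sq]
    exact mul_le_mul i2 i1 (abs_nonneg _) (norm_nonneg _)
  nlinarith [mul_le_mul_of_nonneg_left h3 (norm_nonneg (Complex.Gamma z))]

/-- A product of a Gamma factor and a bounded factor is integrable along vertical lines. -/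
theorem integrable_Gamma_mul_of_bounded {z : ℝ → ℂ} {σ : ℝ} (hσ : 0 < σ)
    (hre : ∀ t, (z t).re = σ) (him : ∀ t, (z t).im ^ 2 = t ^ 2) (hz : Continuous z)
    {h : ℝ → ℂ} (hh : Continuous h) {C : ℝ} (hC : ∀ t, ‖h t‖ ≤ C) :
    Integrable fun t => Complex.Gamma (z t) * h t := by
  have hc : Continuous fun t => Complex.Gamma (z t) := by
    refine continuous_iff_continuousAt.2 fun t => ?_
    refine ContinuousAt.comp (g := Complex.Gamma)
      (Complex.differentiableAt_Gamma _ fun n hn => ?_).continuousAt hz.continuousAt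
    have := congrArg Complex.re hn
    rw [hre] at this
    simp at this
    have : (0 : ℝ) ≤ n := Nat.cast_nonneg n
    linarith
  refine Integrable.mono' ((integrable_inv_one_add_sq).const_mul
    ((Real.Gamma σ + Real.Gamma (σ + 2)) * C)) (hc.mul hh).aestronglyMeasurable
    (Filter.Eventually.of_forall fun t => ?_)
  have hd := norm_Gamma_mul_one_add_sq_le (z := z t) (by rw [hre]; exact hσ)
  rw [hre, him] at hd
  have hp : 0 < 1 + t ^ 2 := by positivity
  rw [norm_mul]
  have hC0 : 0 ≤ C := (norm_nonneg _).trans (hC t)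
  calc _ ≤ ((Real.Gamma σ + Real.Gamma (σ + 2)) / (1 + t ^ 2)) * C := by
        refine mul_le_mul ((le_div_iff₀ hp).2 hd) (hC t) (norm_nonneg _) ?_
        exact div_nonneg ((mul_nonneg (norm_nonneg _) hp.le).trans hd) hp.le
    _ = _ := by ring

theorem continuous_Gamma_comp {z : ℝ → ℂ} (hz : Continuous z) (hre : ∀ t, 0 < (z t).re) :
    Continuous fun t => Complex.Gamma (z t) := by
  refine continuous_iff_continuousAt.2 fun t => ?_
  refine ContinuousAt.comp (g := Complex.Gamma)
    (Complex.differentiableAt_Gamma _ fun n hn => ?_).continuousAt hz.continuousAt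
  have h1 := congrArg Complex.re hn
  have h2 := hre t
  simp at h1
  have : (0 : ℝ) ≤ n := Nat.cast_nonneg n
  linarith

/-! ### Mellin transforms and Mellin-Barnes integrals -/

/-- The Mellin transform of a multiplicative mixture. -/
theorem hasMellin_integral_comp_mul [IsProbabilityMeasure P] {R : Ω → ℝ} (hR : AEMeasurable R P)
    (hpos : ∀ᵐ ω ∂P, 0 < R ω) {k : ℝ → ℂ} (hk : Measurable k) {u : ℂ}
    (hku : MellinConvergent k u) (hRu : Integrable (fun ω => (R ω : ℂ) ^ (-u)) P) :
    HasMellin (fun v => ∫ ω, k (R ω * v) ∂P) u (mellin k u * ∫ ω, (R ω : ℂ) ^ (-u) ∂P) := by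
  set ν : Measure ℝ := volume.restrict (Set.Ioi 0) with hν
  set F : Ω × ℝ → ℂ := fun p => (p.2 : ℂ) ^ (u - 1) * k (R p.1 * p.2) with hF
  have hmeas : AEStronglyMeasurable F (P.prod ν) := by
    have h1 : AEMeasurable (fun p : Ω × ℝ => R p.1) (P.prod ν) :=
      hR.comp_quasiMeasurePreserving Measure.quasiMeasurePreserving_fst
    have h2 : AEMeasurable (fun p : Ω × ℝ => k (R p.1 * p.2)) (P.prod ν) :=
      hk.comp_aemeasurable (h1.mul (by fun_prop))
    exact AEMeasurable.aestronglyMeasurable ((by fun_prop : AEMeasurable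
      (fun p : Ω × ℝ => (p.2 : ℂ) ^ (u - 1)) (P.prod ν)).mul h2)
  -- Rescaling `v` by `R ω` separates the variables, so Fubini's hypothesis reduces to the moment of
  -- order `-u` and the Mellin convergence of `k`.
  have hnorm : ∀ᵐ ω ∂P, ∫ v, ‖F (ω, v)‖ ∂ν =
      ‖(R ω : ℂ) ^ (-u)‖ * ∫ v in Set.Ioi (0 : ℝ), v ^ (u.re - 1) * ‖k v‖ := by
    filter_upwards [hpos] with ω hω
    have := integral_comp_mul_left_Ioi (fun v : ℝ => v ^ (u.re - 1) * ‖k v‖) 0 hω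
    rw [mul_zero, smul_eq_mul] at this
    rw [Complex.norm_cpow_eq_rpow_re_of_pos hω]
    have e : ∫ v, ‖F (ω, v)‖ ∂ν = ∫ v in Set.Ioi (0 : ℝ),
        (R ω) ^ (-(u.re - 1)) * ((R ω * v) ^ (u.re - 1) * ‖k (R ω * v)‖) := by
      refine setIntegral_congr_fun measurableSet_Ioi fun v hv => ?_
      have hv : 0 < v := hv
      simp only [hF]
      rw [norm_mul, Complex.norm_cpow_eq_rpow_re_of_pos hv, Real.mul_rpow hω.le hv.le,
        Real.rpow_neg hω.le]
      have := Real.rpow_pos_of_pos hω (u.re - 1)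
      field_simp
      simp [mul_comm]
    rw [e, integral_const_mul, this, ← mul_assoc, ← Real.rpow_neg_one, ← Real.rpow_add hω]
    congr 2
    simp
    ring
  have hint : Integrable F (P.prod ν) := by
    rw [integrable_prod_iff hmeas]
    constructor
    · filter_upwards [hpos] with ω hω
      have := (MellinConvergent.comp_mul_left hω).2 hku
      simpa [MellinConvergent, smul_eq_mul, IntegrableOn] using this
    · exact (integrable_congr hnorm).2 (hRu.norm.mul_const _)
  have hconv : MellinConvergent (fun v => ∫ ω, k (R ω * v) ∂P) u := by
    have := hint.integral_prod_right
    simp only [hF, integral_const_mul] at this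
    exact this
  refine ⟨hconv, ?_⟩
  calc mellin (fun v => ∫ ω, k (R ω * v) ∂P) u = ∫ v, ∫ ω, F (ω, v) ∂P ∂ν := by
        simp only [hF, integral_const_mul]
        rfl
    _ = ∫ ω, ∫ v, F (ω, v) ∂ν ∂P := (integral_integral_swap (f := fun ω v => F (ω, v)) hint).symm
    _ = ∫ ω, mellin k u * (R ω : ℂ) ^ (-u) ∂P := by
        refine integral_congr_ae ?_
        filter_upwards [hpos] with ω hω
        have := mellin_comp_mul_left k u hω
        rw [smul_eq_mul, mul_comm] at this
        rw [← this]
        rfl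
    _ = _ := integral_const_mul _ _

/-- A common value `L` on all separating lines makes the arbitrary choice of line in `meijerG`
immaterial. -/
theorem meijerGConverges_of_lineIntegral {m n p q : ℕ} {a : Fin p → ℂ} {b : Fin q → ℂ} {z L : ℂ}
    (hne : (meijerAbscissas m n a b).Nonempty)
    (h : ∀ σ ∈ meijerAbscissas m n a b,
      Integrable (fun t : ℝ => meijerIntegrand m n a b z ((σ : ℂ) + (t : ℂ) * Complex.I)) ∧
        meijerLineIntegral m n a b z σ = L) :
    MeijerGConverges m n a b z ∧ meijerG m n a b z = L := by
  have hG : meijerG m n a b z = L := by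
    rw [meijerG, dif_pos hne]
    exact (h _ hne.some_mem).2
  exact ⟨⟨hne, fun σ hσ => ⟨(h σ hσ).1, (h σ hσ).2.trans hG.symm⟩⟩, hG⟩

/-- Mellin-Barnes representation of `𝔼[k (v R)]` for a quotient `R` of independent beta prime
random variables; `H` is the integrand on the line of abscissa `σ`. -/
theorem mellinBarnes_div_betaPrime [IsProbabilityMeasure P] {a b a' b' : ℝ} (ha : 0 < a)
    (hb : 0 < b) (ha' : 0 < a') (hb' : 0 < b') {Y Z : Ω → ℝ}
    (hY : HasLaw Y (betaPrimeMeasure a b) P)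
    (hZ : HasLaw Z (betaPrimeMeasure a' b') P) (hind : IndepFun Y Z P)
    {σ : ℝ} (h0 : 0 < σ) (h1 : σ < a) (h2 : σ < b') {k : ℝ → ℂ} (hk : Measurable k)
    (hk1 : ∀ x, 0 < x → ‖k x‖ ≤ 1) {K : ℂ → ℂ}
    (hK : ∀ u : ℂ, u.re = σ → HasMellin k u (K u))
    (hKc : Continuous fun t : ℝ => K ((σ : ℂ) + (t : ℂ) * Complex.I)) {C : ℝ}
    (hKb : ∀ t : ℝ, ‖K ((σ : ℂ) + (t : ℂ) * Complex.I)‖ ≤ C) {v : ℝ} (hv : 0 < v)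
    (hcont : ∀ᵐ ω ∂P, ContinuousAt k (Y ω / Z ω * v))
    {H : ℂ → ℂ} (hH : ∀ u : ℂ, u.re = σ → H u = (v : ℂ) ^ (-u) * (K u *
      (Complex.Gamma (a - u) * Complex.Gamma (b + u) *
        (Complex.Gamma (a' + u) * Complex.Gamma (b' - u))))) :
    Integrable (fun t : ℝ => H ((σ : ℂ) + (t : ℂ) * Complex.I)) ∧
    1 / (2 * (Real.pi : ℂ)) * ∫ t : ℝ, H ((σ : ℂ) + (t : ℂ) * Complex.I) =
      ((Real.Gamma a * Real.Gamma b * (Real.Gamma a' * Real.Gamma b') : ℝ) : ℂ) *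
        ∫ ω, k (Y ω / Z ω * v) ∂P := by
  set N : ℂ := ((Real.Gamma a * Real.Gamma b * (Real.Gamma a' * Real.Gamma b') : ℝ) : ℂ) with hN
  have hN0 : N ≠ 0 := by
    have := Real.Gamma_pos_of_pos ha
    have := Real.Gamma_pos_of_pos hb
    have := Real.Gamma_pos_of_pos ha'
    have := Real.Gamma_pos_of_pos hb'
    exact Complex.ofReal_ne_zero.2 (by positivity : Real.Gamma a * Real.Gamma b *
      (Real.Gamma a' * Real.Gamma b') ≠ 0)
  have mR : AEMeasurable (fun ω => Y ω / Z ω) P := hY.aemeasurable.div hZ.aemeasurable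
  have pR : ∀ᵐ ω ∂P, 0 < Y ω / Z ω := by
    filter_upwards [ae_of_ae_map hY.aemeasurable (hY.map_eq ▸ ae_pos_betaPrimeMeasure a b),
      ae_of_ae_map hZ.aemeasurable (hZ.map_eq ▸ ae_pos_betaPrimeMeasure a' b')] with ω hy hz
    exact div_pos hy hz
  set M : ℂ → ℂ := fun u => K u * (Complex.Gamma (a - u) * Complex.Gamma (b + u) *
        (Complex.Gamma (a' + u) * Complex.Gamma (b' - u))) with hM
  set f : ℝ → ℂ := fun v => ∫ ω, k (Y ω / Z ω * v) ∂P with hf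
  have hmel : ∀ u : ℂ, u.re = σ → HasMellin f u (N⁻¹ * M u) := by
    intro u hu
    have hm := integrable_cpow_div_betaPrime ha hb ha' hb' hY hZ hind (u := u)
      (by rw [hu]; exact h0) (by rw [hu]; exact h1) (by rw [hu]; exact h2)
    have := hasMellin_integral_comp_mul mR pR hk (hK u hu).1 hm.1
    rw [hm.2, (hK u hu).2] at this
    convert! this using 1
    simp only [hM, hN]
    push_cast
    ring
  have hΓ : ∀ {p : ℝ} {z : ℂ}, z.re = p → 0 < p → ‖Complex.Gamma z‖ ≤ Real.Gamma p := by
    rintro p z rfl hp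
    exact norm_Gamma_le_Gamma_re hp
  -- `Γ(a - u)` alone supplies the decay; the other three Gamma factors and `K` need only be bounded
  -- on the line.
  have hint : Integrable fun t : ℝ => M ((σ : ℂ) + (t : ℂ) * Complex.I) := by
    have := integrable_Gamma_mul_of_bounded (z := fun t : ℝ => a - ((σ : ℂ) + (t : ℂ) * Complex.I))
      (σ := a - σ) (by linarith) (by simp) (by simp) (by fun_prop)
      (h := fun t : ℝ => K ((σ : ℂ) + (t : ℂ) * Complex.I) *
        (Complex.Gamma (b + ((σ : ℂ) + (t : ℂ) * Complex.I)) *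
        (Complex.Gamma (a' + ((σ : ℂ) + (t : ℂ) * Complex.I)) *
          Complex.Gamma (b' - ((σ : ℂ) + (t : ℂ) * Complex.I)))))
      (C := C * (Real.Gamma (b + σ) * (Real.Gamma (a' + σ) * Real.Gamma (b' - σ))))
      (hKc.mul ((continuous_Gamma_comp (by fun_prop) (by intro t; simp; linarith)).mul
        ((continuous_Gamma_comp (by fun_prop) (by intro t; simp; linarith)).mul
        (continuous_Gamma_comp (by fun_prop) (by intro t; simp; linarith)))))
      (by
        intro t
        have hC0 : 0 ≤ C := (norm_nonneg _).trans (hKb t)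
        rw [norm_mul, norm_mul, norm_mul]
        refine mul_le_mul (hKb t) (mul_le_mul (hΓ (by simp) (by linarith)) (mul_le_mul
          (hΓ (by simp) (by linarith)) (hΓ (by simp) (by linarith))
          (norm_nonneg _) ?_) (by positivity) ?_) (by positivity) hC0
        · exact (Real.Gamma_pos_of_pos (by linarith)).le
        · exact (Real.Gamma_pos_of_pos (by linarith)).le)
    refine this.congr (Filter.Eventually.of_forall fun t => ?_)
    simp only [hM]
    ring
  have hre : ∀ t : ℝ, ((σ : ℂ) + (t : ℂ) * Complex.I).re = σ := by simp
  have hvert : Complex.VerticalIntegrable (mellin f) σ := by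
    refine (hint.const_mul N⁻¹).congr (Filter.Eventually.of_forall fun t => ?_)
    exact (hmel _ (hre t)).2.symm
  -- Pointwise inversion needs continuity at `v`. Dominated convergence gives it even if `k` jumps,
  -- provided `v R` almost surely avoids the jump.
  have hfc : ContinuousAt f v := by
    have hev : ∀ᶠ x in nhds v, 0 < x := lt_mem_nhds hv
    refine continuousAt_of_dominated (bound := fun _ => 1) ?_ ?_ (integrable_const _) ?_
    · exact Filter.Eventually.of_forall fun x =>
        (hk.comp_aemeasurable (mR.mul_const x)).aestronglyMeasurable
    · filter_upwards [hev] with x hx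
      filter_upwards [pR] with ω hω
      exact hk1 _ (mul_pos hω hx)
    · filter_upwards [hcont] with ω hω
      exact ContinuousAt.comp (g := k) hω (by fun_prop)
  have hinv := mellinInv_mellin_eq σ f hv (hmel σ (by simp)).1 hvert hfc
  have hHM : ∀ t : ℝ, H ((σ : ℂ) + (t : ℂ) * Complex.I) =
      N * ((v : ℂ) ^ (-((σ : ℂ) + (t : ℂ) * Complex.I)) •
        mellin f ((σ : ℂ) + (t : ℂ) * Complex.I)) := by
    intro t
    rw [hH _ (hre t), (hmel _ (hre t)).2, smul_eq_mul, mul_left_comm N,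
      mul_inv_cancel_left₀ hN0]
  constructor
  · simp_rw [hHM]
    refine Integrable.const_mul ?_ N
    refine Integrable.bdd_mul (c := v ^ (-σ)) hvert ?_ ?_
    · exact (Continuous.const_cpow (by fun_prop)
        (Or.inl (by exact_mod_cast hv.ne'))).aestronglyMeasurable
    · refine Filter.Eventually.of_forall fun t => ?_
      rw [Complex.norm_cpow_eq_rpow_re_of_pos hv]
      simp
  · simp_rw [hHM]
    rw [integral_const_mul, show ∫ ω, k (Y ω / Z ω * v) ∂P = f v from rfl, ← hinv, mellinInv, Complex.real_smul]
    push_cast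
    ring

/-! ### Meijer's function for the two kernels -/

/-- The match is `w = m₁ - u`. The third upper parameter puts `Γ(1 + u)` in the denominator, which
with `Γ(u)` leaves `1 / u`. -/
theorem meijerIntegrand_cdf {m₁ ms₁ m₂ ms₂ v : ℝ} (hv : 0 < v) {u : ℂ} (hu : 0 < u.re) :
    meijerIntegrand 3 2 ![1, 1 - (ms₂ : ℂ) + m₁, m₁ + 1] ![(m₁ : ℂ), m₁ + ms₁, m₁ + m₂] (v : ℂ)
      (m₁ - u) =
    ((v ^ m₁ : ℝ) : ℂ) * ((v : ℂ) ^ (-u) * (1 / u * (Complex.Gamma (m₁ - u) *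
      Complex.Gamma (ms₁ + u) * (Complex.Gamma (m₂ + u) * Complex.Gamma (ms₂ - u))))) := by
  have hu0 : u ≠ 0 := by rintro rfl; simp at hu
  have hG : Complex.Gamma u ≠ 0 := Complex.Gamma_ne_zero_of_re_pos hu
  rw [sub_eq_add_neg (m₁ : ℂ) u, meijerIntegrand,
    Complex.cpow_add _ _ (by exact_mod_cast hv.ne' : (v : ℂ) ≠ 0), Complex.ofReal_cpow hv.le]
  simp only [Fin.prod_univ_three, Fin.isValue, Fin.val_zero, Fin.val_one, Fin.val_two,
    Matrix.cons_val_zero, Matrix.cons_val_one, Matrix.cons_val]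
  norm_num
  have e : 1 - (1 - (ms₂ : ℂ) + m₁) + (m₁ + -u) = ms₂ - u := by ring
  rw [e, add_comm 1 u, Complex.Gamma_add_one _ hu0]
  field_simp

/-- Here the match is `w = u - m₁`, of opposite orientation, which is why the argument is `v⁻¹`
instead of `v`. -/
theorem meijerIntegrand_mgf {m₁ ms₁ m₂ ms₂ v : ℝ} (hv : 0 < v) (u : ℂ) :
    meijerIntegrand 2 3 ![1 - (m₁ : ℂ) - ms₁, 1 - (m₁ : ℂ) - m₂, 1 - (m₁ : ℂ)] ![0, -(m₁ : ℂ) + ms₂]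
      ((v⁻¹ : ℝ) : ℂ) (u - m₁) =
    ((v ^ m₁ : ℝ) : ℂ) * ((v : ℂ) ^ (-u) * (Complex.Gamma u * (Complex.Gamma (m₁ - u) *
      Complex.Gamma (ms₁ + u) * (Complex.Gamma (m₂ + u) * Complex.Gamma (ms₂ - u))))) := by
  have hz : ((v⁻¹ : ℝ) : ℂ) ^ (u - m₁) = (v : ℂ) ^ (-u) * (v : ℂ) ^ (m₁ : ℂ) := by
    rw [← Complex.cpow_add _ _ (by exact_mod_cast hv.ne' : (v : ℂ) ≠ 0), Complex.ofReal_inv,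
      Complex.inv_cpow _ _ (by rw [Complex.arg_ofReal_of_nonneg hv.le]; exact Real.pi_pos.ne),
      ← Complex.cpow_neg]
    congr 1; ring
  rw [meijerIntegrand, hz, Complex.ofReal_cpow hv.le]
  simp only [Fin.prod_univ_three, Fin.prod_univ_two, Fin.isValue, Fin.val_zero, Fin.val_one,
    Fin.val_two, Matrix.cons_val_zero, Matrix.cons_val_one, Matrix.cons_val]
  norm_num
  have e5 : -(m₁ : ℂ) + ms₂ - (u - m₁) = ms₂ - u := by ring
  have e6 : 1 - (1 - (m₁ : ℂ) - ms₁) + (u - m₁) = ms₁ + u := by ring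
  have e7 : 1 - (1 - (m₁ : ℂ) - m₂) + (u - m₁) = m₂ + u := by ring
  simp only [e5, e6, e7]
  ring

theorem hasMellin_exp_neg {u : ℂ} (hu : 0 < u.re) :
    HasMellin (fun x : ℝ => ((Real.exp (-x) : ℝ) : ℂ)) u (Complex.Gamma u) := by
  constructor
  · have := Complex.GammaIntegral_convergent hu
    refine this.congr_fun (fun x _ => ?_) measurableSet_Ioi
    simp [mul_comm]
  · rw [Complex.Gamma_eq_integral hu, Complex.GammaIntegral_eq_mellin]

theorem meijerG_cdf [IsProbabilityMeasure P] {m₁ ms₁ m₂ ms₂ : ℝ} (h₁ : 0 < m₁)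
    (hs₁ : 0 < ms₁) (h₂ : 0 < m₂) (hs₂ : 0 < ms₂) {Y Z : Ω → ℝ}
    (hY : HasLaw Y (betaPrimeMeasure m₁ ms₁) P) (hZ : HasLaw Z (betaPrimeMeasure m₂ ms₂) P)
    (hind : IndepFun Y Z P) {v : ℝ} (hv : 0 < v) :
    MeijerGConverges 3 2 ![1, 1 - (ms₂ : ℂ) + m₁, m₁ + 1] ![(m₁ : ℂ), m₁ + ms₁, m₁ + m₂] (v : ℂ) ∧
    meijerG 3 2 ![1, 1 - (ms₂ : ℂ) + m₁, m₁ + 1] ![(m₁ : ℂ), m₁ + ms₁, m₁ + m₂] (v : ℂ) =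
      ((v ^ m₁ * (Real.Gamma m₁ * Real.Gamma ms₁ * (Real.Gamma m₂ * Real.Gamma ms₂)) : ℝ) : ℂ) *
        ∫ ω, (Set.Ioc (0 : ℝ) 1).indicator (fun _ => (1 : ℂ)) (Y ω / Z ω * v) ∂P := by
  have habs : meijerAbscissas 3 2 ![1, 1 - (ms₂ : ℂ) + m₁, m₁ + 1] ![(m₁ : ℂ), m₁ + ms₁, m₁ + m₂] =
      {σ | 0 < σ ∧ m₁ - ms₂ < σ ∧ σ < m₁} := by
    ext σ
    simp only [meijerAbscissas, Fin.forall_fin_succ, Set.mem_ofPred_eq]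
    simp
    constructor
    · rintro ⟨⟨a, b⟩, c, d, e⟩
      exact ⟨a, by linarith, c⟩
    · rintro ⟨a, b, c⟩
      exact ⟨⟨a, by linarith⟩, c, by linarith, by linarith⟩
  refine meijerGConverges_of_lineIntegral ?_ ?_
  · rw [habs]
    obtain ⟨σ, h, h'⟩ := exists_between (max_lt h₁ (by linarith : m₁ - ms₂ < m₁))
    exact ⟨σ, (le_max_left _ _).trans_lt h, (le_max_right _ _).trans_lt h, h'⟩
  · intro σ hσ
    rw [habs] at hσ
    obtain ⟨hσ0, hσ1, hσ2⟩ := hσ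
    have hre : ∀ t : ℝ, (((m₁ - σ : ℝ) : ℂ) + (t : ℂ) * Complex.I).re = m₁ - σ := by simp
    -- The law of `R` has a density, so `R v` almost surely misses the jump of the indicator at `1`.
    have hatom : ∀ᵐ ω ∂P, Y ω / Z ω ≠ 1 / v := by
      have hl := hasLaw_div_betaPrime h₁ hs₁ h₂ hs₂ hY hZ hind
      refine ae_of_ae_map hl.aemeasurable (p := fun r => r ≠ 1 / v) ?_
      rw [hl.map_eq]
      exact (withDensity_absolutelyContinuous _ _).ae_le
        (compl_mem_ae_iff.2 (measure_singleton _))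
    have key := mellinBarnes_div_betaPrime h₁ hs₁ h₂ hs₂ hY hZ hind (σ := m₁ - σ) (by linarith)
      (by linarith) (by linarith) (k := (Set.Ioc (0 : ℝ) 1).indicator (fun _ => (1 : ℂ)))
      (measurable_const.indicator measurableSet_Ioc)
      (by
        intro x _
        refine (norm_indicator_le_norm_self _ _).trans (by simp))
      (K := fun u => 1 / u)
      (fun u hu => hasMellin_one_Ioc (by rw [hu]; linarith))
      (by
        refine Continuous.div₀ (by fun_prop) (by fun_prop) fun t h => ?_
        have := congrArg Complex.re h
        rw [hre, Complex.zero_re] at this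
        linarith)
      (C := 1 / (m₁ - σ))
      (by
        intro t
        rw [norm_div, norm_one]
        refine one_div_le_one_div_of_le (by linarith) ?_
        have := Complex.re_le_norm (((m₁ - σ : ℝ) : ℂ) + (t : ℂ) * Complex.I)
        rwa [hre] at this)
      hv
      (by
        filter_upwards [hatom, ae_of_ae_map hY.aemeasurable
          (hY.map_eq ▸ ae_pos_betaPrimeMeasure m₁ ms₁), ae_of_ae_map hZ.aemeasurable
          (hZ.map_eq ▸ ae_pos_betaPrimeMeasure m₂ ms₂)] with ω hω hy hz
        have hpos : 0 < Y ω / Z ω * v := mul_pos (div_pos hy hz) hv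
        have hne : Y ω / Z ω * v ≠ 1 := fun h => hω ((eq_div_iff hv.ne').2 h)
        rcases lt_or_gt_of_ne hne with h | h
        · refine (continuousAt_const (y := (1 : ℂ))).congr ?_
          filter_upwards [Ioo_mem_nhds hpos h] with x hx
          rw [Set.indicator_of_mem (Set.mem_Ioc.2 ⟨hx.1, hx.2.le⟩)]
        · refine (continuousAt_const (y := (0 : ℂ))).congr ?_
          filter_upwards [lt_mem_nhds h] with x hx
          rw [Set.indicator_of_notMem fun h' => not_le_of_gt hx h'.2])
      (H := fun u => (v : ℂ) ^ (-u) * (1 / u * (Complex.Gamma (m₁ - u) * Complex.Gamma (ms₁ + u) *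
        (Complex.Gamma (m₂ + u) * Complex.Gamma (ms₂ - u)))))
      (fun u _ => rfl)
    have hline : ∀ t : ℝ, meijerIntegrand 3 2 ![1, 1 - (ms₂ : ℂ) + m₁, m₁ + 1]
        ![(m₁ : ℂ), m₁ + ms₁, m₁ + m₂] (v : ℂ) ((σ : ℂ) + (t : ℂ) * Complex.I) =
        ((v ^ m₁ : ℝ) : ℂ) * (fun u : ℂ => (v : ℂ) ^ (-u) * (1 / u * (Complex.Gamma (m₁ - u) *
          Complex.Gamma (ms₁ + u) * (Complex.Gamma (m₂ + u) * Complex.Gamma (ms₂ - u)))))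
          (((m₁ - σ : ℝ) : ℂ) + ((-t : ℝ) : ℂ) * Complex.I) := by
      intro t
      have := meijerIntegrand_cdf (m₁ := m₁) (ms₁ := ms₁) (m₂ := m₂) (ms₂ := ms₂) hv
        (u := ((m₁ - σ : ℝ) : ℂ) + ((-t : ℝ) : ℂ) * Complex.I) (by rw [hre]; linarith)
      rw [← this]
      congr 1
      push_cast; ring
    constructor
    · simp_rw [hline]
      exact (key.1.comp_neg).const_mul _
    · rw [meijerLineIntegral]
      simp_rw [hline]
      -- The substitution `w = m₁ - u` reverses the line, undone by `t ↦ -t`.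
      rw [integral_const_mul, integral_neg_eq_self (fun t : ℝ => (fun u : ℂ => (v : ℂ) ^ (-u) *
        (1 / u * (Complex.Gamma (m₁ - u) * Complex.Gamma (ms₁ + u) * (Complex.Gamma (m₂ + u) *
        Complex.Gamma (ms₂ - u))))) (((m₁ - σ : ℝ) : ℂ) + (t : ℂ) * Complex.I)),
        mul_left_comm, key.2, ← mul_assoc, ← Complex.ofReal_mul]

theorem meijerG_mgf [IsProbabilityMeasure P] {m₁ ms₁ m₂ ms₂ : ℝ} (h₁ : 0 < m₁)
    (hs₁ : 0 < ms₁) (h₂ : 0 < m₂) (hs₂ : 0 < ms₂) {Y Z : Ω → ℝ}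
    (hY : HasLaw Y (betaPrimeMeasure m₁ ms₁) P) (hZ : HasLaw Z (betaPrimeMeasure m₂ ms₂) P)
    (hind : IndepFun Y Z P) {v : ℝ} (hv : 0 < v) :
    MeijerGConverges 2 3 ![1 - (m₁ : ℂ) - ms₁, 1 - (m₁ : ℂ) - m₂, 1 - (m₁ : ℂ)]
      ![0, -(m₁ : ℂ) + ms₂] ((v⁻¹ : ℝ) : ℂ) ∧
    meijerG 2 3 ![1 - (m₁ : ℂ) - ms₁, 1 - (m₁ : ℂ) - m₂, 1 - (m₁ : ℂ)]
      ![0, -(m₁ : ℂ) + ms₂] ((v⁻¹ : ℝ) : ℂ) =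
      ((v ^ m₁ * (Real.Gamma m₁ * Real.Gamma ms₁ * (Real.Gamma m₂ * Real.Gamma ms₂)) : ℝ) : ℂ) *
        ∫ ω, ((Real.exp (-(Y ω / Z ω * v)) : ℝ) : ℂ) ∂P := by
  have habs : meijerAbscissas 2 3 ![1 - (m₁ : ℂ) - ms₁, 1 - (m₁ : ℂ) - m₂, 1 - (m₁ : ℂ)]
      ![0, -(m₁ : ℂ) + ms₂] = {σ | -m₁ < σ ∧ σ < 0 ∧ σ < ms₂ - m₁} := by
    ext σ
    simp only [meijerAbscissas, Fin.forall_fin_succ, Set.mem_ofPred_eq]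
    simp
    constructor
    · rintro ⟨⟨a, b, c⟩, d, e⟩
      exact ⟨by linarith, d, by linarith⟩
    · rintro ⟨a, b, c⟩
      exact ⟨⟨by linarith, by linarith, by linarith⟩, b, by linarith⟩
  refine meijerGConverges_of_lineIntegral ?_ ?_
  · rw [habs]
    obtain ⟨σ, h, h'⟩ := exists_between
      (lt_min (by linarith : -m₁ < 0) (by linarith : -m₁ < ms₂ - m₁))
    exact ⟨σ, h, h'.trans_le (min_le_left _ _), h'.trans_le (min_le_right _ _)⟩
  · intro σ hσ
    rw [habs] at hσ
    obtain ⟨hσ0, hσ1, hσ2⟩ := hσ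
    have hre : ∀ t : ℝ, (((σ + m₁ : ℝ) : ℂ) + (t : ℂ) * Complex.I).re = σ + m₁ := by simp
    have key := mellinBarnes_div_betaPrime h₁ hs₁ h₂ hs₂ hY hZ hind (σ := σ + m₁) (by linarith)
      (by linarith) (by linarith) (k := fun x : ℝ => ((Real.exp (-x) : ℝ) : ℂ)) (by fun_prop)
      (by
        intro x hx
        rw [Complex.norm_real, Real.norm_of_nonneg (Real.exp_pos _).le, Real.exp_le_one_iff]
        linarith)
      (K := Complex.Gamma)
      (fun u hu => hasMellin_exp_neg (by rw [hu]; linarith))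
      (continuous_Gamma_comp (by fun_prop) fun t => by rw [hre]; linarith)
      (C := Real.Gamma (σ + m₁))
      (by
        intro t
        have := norm_Gamma_le_Gamma_re (z := ((σ + m₁ : ℝ) : ℂ) + (t : ℂ) * Complex.I)
          (by rw [hre]; linarith)
        rwa [hre] at this)
      hv
      (Filter.Eventually.of_forall fun ω => by fun_prop)
      (H := fun u => (v : ℂ) ^ (-u) * (Complex.Gamma u * (Complex.Gamma (m₁ - u) *
        Complex.Gamma (ms₁ + u) * (Complex.Gamma (m₂ + u) * Complex.Gamma (ms₂ - u)))))
      (fun u _ => rfl)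
    have hline : ∀ t : ℝ, meijerIntegrand 2 3
        ![1 - (m₁ : ℂ) - ms₁, 1 - (m₁ : ℂ) - m₂, 1 - (m₁ : ℂ)]
        ![0, -(m₁ : ℂ) + ms₂] ((v⁻¹ : ℝ) : ℂ) ((σ : ℂ) + (t : ℂ) * Complex.I) =
        ((v ^ m₁ : ℝ) : ℂ) * (fun u : ℂ => (v : ℂ) ^ (-u) * (Complex.Gamma u *
          (Complex.Gamma (m₁ - u) * Complex.Gamma (ms₁ + u) *
          (Complex.Gamma (m₂ + u) * Complex.Gamma (ms₂ - u)))))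
          (((σ + m₁ : ℝ) : ℂ) + (t : ℂ) * Complex.I) := by
      intro t
      have := meijerIntegrand_mgf (m₁ := m₁) (ms₁ := ms₁) (m₂ := m₂) (ms₂ := ms₂) hv
        (((σ + m₁ : ℝ) : ℂ) + (t : ℂ) * Complex.I)
      rw [← this]
      congr 1
      push_cast; ring
    constructor
    · simp_rw [hline]
      exact key.1.const_mul _
    · rw [meijerLineIntegral]
      simp_rw [hline]
      rw [integral_const_mul, mul_left_comm, key.2, ← mul_assoc, ← Complex.ofReal_mul]

end

/-! ### The theorem for the Fisher–Snedecor quotient -/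

theorem corollary1 {Ω : Type*} [MeasurableSpace Ω] (P : Measure Ω) [IsProbabilityMeasure P]
    (g₁ m₁ ms₁ g₂ m₂ ms₂ : ℝ)
    (hg₁ : 0 < g₁) (hm₁ : 1 / 2 < m₁) (hms₁ : 1 < ms₁)
    (hg₂ : 0 < g₂) (hm₂ : 1 / 2 < m₂) (hms₂ : 1 < ms₂)
    (γ₁ γ₂ : Ω → ℝ)
    (hγ₁ : HasLaw γ₁ (squaredFMeasure g₁ m₁ ms₁) P)
    (hγ₂ : HasLaw γ₂ (squaredFMeasure g₂ m₂ ms₂) P)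
    (hindep : IndepFun γ₁ γ₂ P)
    (X : Ω → ℝ) (hX : X = fun ω => γ₁ ω / γ₂ ω)
    (c : ℝ) (hc : c = (ms₂ - 1) * g₂ * m₁ / ((ms₁ - 1) * g₁ * m₂)) :
    -- the probability density function
    HasLaw X
      (volume.withDensity fun x : ℝ => ENNReal.ofReal
        (if 0 < x then
          beta (m₁ + m₂) (ms₁ + ms₂) * x ^ (m₁ - 1) / (beta m₁ ms₁ * beta m₂ ms₂) * c ^ m₁ *
            gaussHypergeometric (m₁ + ms₁) (m₁ + m₂) ((m₁ + ms₁) + (m₂ + ms₂)) (1 - c * x)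
        else 0)) P ∧
    -- the cumulative distribution function
    (∀ x : ℝ, 0 < x →
      MeijerGConverges 3 2 ![1, 1 - ms₂ + m₁, m₁ + 1] ![m₁, m₁ + ms₁, m₁ + m₂]
        ((1 / (c * x) : ℝ) : ℂ) ∧
      ((cdf (P.map X) x : ℝ) : ℂ) =
        (((c * x) ^ m₁ /
          (Real.Gamma m₁ * Real.Gamma ms₁ * (Real.Gamma m₂ * Real.Gamma ms₂)) : ℝ) : ℂ) *
        meijerG 3 2 ![1, 1 - ms₂ + m₁, m₁ + 1] ![m₁, m₁ + ms₁, m₁ + m₂]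
          ((1 / (c * x) : ℝ) : ℂ)) ∧
    -- the moment generating function `s ↦ 𝔼[exp (-s X)]`
    (∀ s : ℝ, 0 < s →
      Integrable (fun ω => Real.exp (-s * X ω)) P ∧
      MeijerGConverges 2 3 ![1 - m₁ - ms₁, 1 - m₁ - m₂, 1 - m₁] ![0, -m₁ + ms₂]
        ((c / s : ℝ) : ℂ) ∧
      ((mgf X P (-s) : ℝ) : ℂ) =
        (((c / s) ^ m₁ /
          (Real.Gamma m₁ * Real.Gamma ms₁ * (Real.Gamma m₂ * Real.Gamma ms₂)) : ℝ) : ℂ) *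
        meijerG 2 3 ![1 - m₁ - ms₁, 1 - m₁ - m₂, 1 - m₁] ![0, -m₁ + ms₂]
          ((c / s : ℝ) : ℂ)) := by

  have h₁ : 0 < m₁ := by linarith
  have h₂ : 0 < m₂ := by linarith
  have hs₁ : 0 < ms₁ := by linarith
  have hs₂ : 0 < ms₂ := by linarith
  have hk₁ : 0 < ms₁ - 1 := by linarith
  have hk₂ : 0 < ms₂ - 1 := by linarith
  have hl₁ : 0 < (ms₁ - 1) * g₁ / m₁ := by positivity
  have hl₂ : 0 < (ms₂ - 1) * g₂ / m₂ := by positivity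
  have hc0 : 0 < c := by rw [hc]; positivity
  obtain ⟨Y, hYd⟩ : ∃ Y : Ω → ℝ, Y = fun ω => γ₁ ω / ((ms₁ - 1) * g₁ / m₁) := ⟨_, rfl⟩
  obtain ⟨Z, hZd⟩ : ∃ Z : Ω → ℝ, Z = fun ω => γ₂ ω / ((ms₂ - 1) * g₂ / m₂) := ⟨_, rfl⟩
  have hY : HasLaw Y (betaPrimeMeasure m₁ ms₁) P :=
    hYd ▸ hasLaw_betaPrime_of_squaredF hg₁ h₁ hms₁ hγ₁
  have hZ : HasLaw Z (betaPrimeMeasure m₂ ms₂) P :=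
    hZd ▸ hasLaw_betaPrime_of_squaredF hg₂ h₂ hms₂ hγ₂
  have hind : IndepFun Y Z P := by
    rw [hYd, hZd]
    exact hindep.comp (φ := fun x => x / ((ms₁ - 1) * g₁ / m₁))
      (ψ := fun x => x / ((ms₂ - 1) * g₂ / m₂)) (by fun_prop) (by fun_prop)
  have hXR : X = fun ω => Y ω / Z ω / c := by
    rw [hX, hYd, hZd, hc]
    ext ω
    -- Where `γ₂` vanishes both sides are `0` by the convention for division, so the identity holds
    -- everywhere.
    rcases eq_or_ne (γ₂ ω) 0 with h | h
    · simp [h]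
    · field_simp
  have hXm : AEMeasurable X P := by
    rw [hX]; exact hγ₁.aemeasurable.div hγ₂.aemeasurable
  have hXpos : ∀ᵐ ω ∂P, 0 < X ω := by
    filter_upwards [ae_of_ae_map hY.aemeasurable (hY.map_eq ▸ ae_pos_betaPrimeMeasure m₁ ms₁),
      ae_of_ae_map hZ.aemeasurable (hZ.map_eq ▸ ae_pos_betaPrimeMeasure m₂ ms₂)] with ω hy hz
    rw [hXR]
    exact div_pos (div_pos hy hz) hc0
  have hN : 0 < Real.Gamma m₁ * Real.Gamma ms₁ * (Real.Gamma m₂ * Real.Gamma ms₂) := by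
    have := Real.Gamma_pos_of_pos h₁
    have := Real.Gamma_pos_of_pos hs₁
    have := Real.Gamma_pos_of_pos h₂
    have := Real.Gamma_pos_of_pos hs₂
    positivity
  have hRX : ∀ ω, Y ω / Z ω = c * X ω := fun ω => by
    rw [hXR]; field_simp
  refine ⟨?_, fun x hx => ?_, fun s hs => ?_⟩
  · have h := hasLaw_div_const (measurable_betaPrimeRatioPDF_ofReal h₁ hs₁ h₂ hs₂) hc0
      (hasLaw_div_betaPrime h₁ hs₁ h₂ hs₂ hY hZ hind)
    rw [← hXR] at h
    convert! h using 2
    ext x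
    rw [← ENNReal.ofReal_mul hc0.le, betaPrimeRatioPDF]
    congr 1
    by_cases hx : 0 < x
    · rw [if_pos hx, if_pos (mul_pos hc0 hx), Real.mul_rpow hc0.le hx.le,
        Real.rpow_sub_one hc0.ne']
      field_simp
    · rw [if_neg hx, if_neg (by rwa [mul_pos_iff_of_pos_left hc0]), mul_zero]
  · have hv : 0 < 1 / (c * x) := by positivity
    obtain ⟨hconv, hG⟩ := meijerG_cdf h₁ hs₁ h₂ hs₂ hY hZ hind hv
    refine ⟨hconv, ?_⟩
    have hint : ∫ ω, (Set.Ioc (0 : ℝ) 1).indicator (fun _ => (1 : ℂ))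
        (Y ω / Z ω * (1 / (c * x))) ∂P = ((cdf (P.map X) x : ℝ) : ℂ) := by
      -- As `R / (c x) = X / x` and `X > 0` almost surely, the kernel `(0, 1]` detects exactly `X ≤
      -- x`.
      have e : (fun ω => (Set.Ioc (0 : ℝ) 1).indicator (fun _ => (1 : ℂ))
          (Y ω / Z ω * (1 / (c * x)))) =ᵐ[P]
          fun ω => (Set.Iic x).indicator (fun _ => (1 : ℂ)) (X ω) := by
        filter_upwards [hXpos] with ω hω
        have e1 : Y ω / Z ω * (1 / (c * x)) = X ω / x := by
          rw [hRX]; field_simp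
        rw [e1]
        have : X ω / x ∈ Set.Ioc (0 : ℝ) 1 ↔ X ω ∈ Set.Iic x := by
          rw [Set.mem_Ioc, div_le_one hx, Set.mem_Iic]
          exact and_iff_right (div_pos hω hx)
        by_cases h : X ω ∈ Set.Iic x
        · rw [Set.indicator_of_mem h, Set.indicator_of_mem (this.2 h)]
        · rw [Set.indicator_of_notMem h, Set.indicator_of_notMem (fun h' => h (this.1 h'))]
      have : IsProbabilityMeasure (P.map X) := Measure.isProbabilityMeasure_map hXm
      rw [integral_congr_ae e, cdf_eq_real, ← integral_map (φ := X)
        (f := (Set.Iic x).indicator (fun _ => (1 : ℂ))) hXm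
        (measurable_const.indicator measurableSet_Iic).aestronglyMeasurable,
        integral_indicator_const _ measurableSet_Iic]
      simp
    rw [hG, hint, ← mul_assoc, ← Complex.ofReal_mul]
    have hone : (c * x) ^ m₁ / (Real.Gamma m₁ * Real.Gamma ms₁ * (Real.Gamma m₂ * Real.Gamma ms₂)) *
        ((1 / (c * x)) ^ m₁ *
          (Real.Gamma m₁ * Real.Gamma ms₁ * (Real.Gamma m₂ * Real.Gamma ms₂))) = 1 := by
      have hp := Real.rpow_pos_of_pos (mul_pos hc0 hx) m₁
      rw [Real.div_rpow zero_le_one (by positivity), Real.one_rpow]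
      generalize Real.Gamma m₁ * Real.Gamma ms₁ * (Real.Gamma m₂ * Real.Gamma ms₂) = N at hN
      field_simp
    rw [hone, Complex.ofReal_one, one_mul]
  · have hv : 0 < s / c := by positivity
    obtain ⟨hconv, hG⟩ := meijerG_mgf h₁ hs₁ h₂ hs₂ hY hZ hind hv
    -- With `v = s / c` the Meijer argument `v⁻¹` is `c / s`.
    rw [inv_div] at hconv hG
    refine ⟨?_, hconv, ?_⟩
    · refine Integrable.mono' (integrable_const 1)
        (Real.measurable_exp.comp_aemeasurable (hXm.const_mul (-s))).aestronglyMeasurable ?_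
      filter_upwards [hXpos] with ω hω
      rw [Real.norm_of_nonneg (Real.exp_pos _).le, Real.exp_le_one_iff]
      nlinarith
    have hint : ∫ ω, ((Real.exp (-(Y ω / Z ω * (s / c))) : ℝ) : ℂ) ∂P =
        ((mgf X P (-s) : ℝ) : ℂ) := by
      rw [integral_complex_ofReal, mgf]
      congr 2
      ext ω
      rw [hRX]
      congr 1
      field_simp
    rw [hG, hint, ← mul_assoc, ← Complex.ofReal_mul]
    have hone : (c / s) ^ m₁ / (Real.Gamma m₁ * Real.Gamma ms₁ * (Real.Gamma m₂ * Real.Gamma ms₂)) *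
        ((s / c) ^ m₁ *
          (Real.Gamma m₁ * Real.Gamma ms₁ * (Real.Gamma m₂ * Real.Gamma ms₂))) = 1 := by
      have hp := Real.rpow_pos_of_pos hs m₁
      have hp' := Real.rpow_pos_of_pos hc0 m₁
      rw [Real.div_rpow hc0.le hs.le, Real.div_rpow hs.le hc0.le]
      generalize Real.Gamma m₁ * Real.Gamma ms₁ * (Real.Gamma m₂ * Real.Gamma ms₂) = N at hN
      field_simp
    rw [hone, Complex.ofReal_one, one_mul]
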